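/- Elliptic problem, Wasserstein sensitivity. Let $d\ge 1$ and let $D\subset\mathbb R^d$ be a bounded open set (for instance a bounded Lipschitz domain, $d=2,3$). Let $L^\infty_+(D)=\{a\in L^\infty(D):\operatorname{ess\,inf}_D a>0\}$, and let the data space $\mathcal X=L^\infty_+(D)\times L^2(D)$ carry the metric $$d_{\mathcal X}\big((a_1,f_1),(a_2,f_2)\big)=\|\log a_1-\log a_2\|_{L^\infty(D)}+\|f_1-f_2\|_{L^2(D)}$$ and its Borel $\sigma$-algebra. Let $H_0^1(D)$ be the closure of $C_c^\infty(D)$ in the $H^1$-norm, with the norm $\|u\|_{H_0^1(D)}=\|\nabla u\|_{L^2(D)}$ and the Borel $\sigma$-algebra, and let $c$ be the Poincaré constant of $D$, i.e. the least $c\ge 0$ with $\|v\|_{L^2(D)}\le c\,\|\nabla v\|_{L^2(D)}$ for all $v\in H_0^1(D)$. For a metric space $X$ and $p\ge 1$, $\mathcal P_p(X)$ denotes the set of Borel probability measures $\mu$ on $X$ with $\int d_X(x,x_0)^p\,\mu(\mathrm dx)<\infty$ for some $x_0\in X$, and $$d_p(\mu,\nu)=\inf_\pi\Big(\int_{X\times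 X} d_X(x,y)^p\,\pi(\mathrm dx,\mathrm dy)\Big)^{1/p}\in[0,\infty],$$ where the infimum is over all Borel probability measures $\pi$ on $X\times X$ with marginals $\mu$ and $\nu$ (and is $\infty$ if there are none). (i) For every $(a,f)\in\mathcal X$ there is exactly one $u=:\mathcal S(a,f)\in H_0^1(D)$ with $\int_D a\,\nabla u\cdot\nabla v\,\mathrm dx=\int_D f\,v\,\mathrm dx$ for all $v\in H_0^1(D)$, i.e. exactly one weak solution of $-\nabla\cdot(a\nabla u)=f$ in $D$, $u=0$ on $\partial D$. It satisfies $\|u\|_{H_0^1(D)}\le \frac{c}{a_{\min}}\|f\|_{L^2(D)}$ whenever $a_{\min}>0$ and $a\ge a_{\min}$ a.e. in $D$. The map $\mathcal S:\mathcal X\to H_0^1(D)$ is Borel measurable. (ii) Let $p\in[1,\infty)$, let $C<\infty$, and let $P,Q$ be Borel probability measures on $\mathcal X$ with $$\int (1+\|f\|_{L^2(D)})^{2p}\exp\big(6p\,\|\log a\|_{L^\infty(D)}\big)\,\mathrm dP\le C,\qquad \int (1+\|f\|_{L^2(D)})^{2p}\exp\big(6p\,\|\log a\|_{L^\infty(D)}\big)\,\mathrm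 dQ\le C.$$ Then $P,Q\in\mathcal P_{2p}(\mathcal X)$, the pushforward measures satisfy $\mathcal S_*P,\mathcal S_*Q\in\mathcal P_p(H_0^1(D))$, and $$d_p(\mathcal S_*P,\mathcal S_*Q)\le 2c\,C^{1/(2p)}\,d_{2p}(P,Q).$$ In particular, if $c\ge 1$, then also $d_p(\mathcal S_*P,\mathcal S_*Q)\le 2c^2\,C^{1/(2p)}\,d_{2p}(P,Q)$. -/

import Mathlib

open MeasureTheory Set
open scoped ENNReal ContDiff

noncomputable section

namespace EllipticUQ

/-! ### Wasserstein distances on a (pseudo-)metric space with its Borel sigma-algebra -/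

section Wasserstein

variable {X : Type*} [PseudoMetricSpace X] [MeasurableSpace X] [BorelSpace X]

/-- `μ` is a probability measure on `X` with finite moment of order `p`. -/
def HasMoment (p : ℝ) (μ : Measure X) : Prop :=
  IsProbabilityMeasure μ ∧ ∃ x₀ : X, ∫⁻ x, edist x x₀ ^ p ∂μ < ⊤

/-- `π` is a coupling of `μ` and `ν`: a Borel probability measure on the metric space `X × X`
with marginals `μ` and `ν`. The Borel sigma-algebra of `X × X` is written explicitly, since for
non-separable `X` it may be larger than the product of the Borel sigma-algebras (and the distance
need only be measurable for the former). -/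
def IsCoupling (μ ν : Measure X) (π : @Measure (X × X) (borel (X × X))) : Prop :=
  @IsProbabilityMeasure (X × X) (borel (X × X)) π ∧
    (∀ A : Set X, MeasurableSet A → π (A ×ˢ univ) = μ A) ∧
    (∀ B : Set X, MeasurableSet B → π (univ ×ˢ B) = ν B)

/-- The `p`-Wasserstein distance, with values in `[0, ∞]`. -/
def wasserstein (p : ℝ) (μ ν : Measure X) : ℝ≥0∞ :=
  ⨅ (π : @Measure (X × X) (borel (X × X))) (_ : IsCoupling μ ν π),
    (@lintegral (X × X) (borel (X × X)) π (fun z => edist z.1 z.2 ^ p)) ^ (1 / p)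

end Wasserstein

/-! ### Function spaces on a set `D ⊆ ℝ^d` -/

variable {d : ℕ}

/-- `L^∞(D)`. -/
abbrev LInf (D : Set (EuclideanSpace ℝ (Fin d))) : Type :=
  Lp ℝ ∞ (volume.restrict D)

/-- `L²(D)`. -/
abbrev L2 (D : Set (EuclideanSpace ℝ (Fin d))) : Type :=
  Lp ℝ 2 (volume.restrict D)

/-- `L²(D; ℝ^d)`. -/
abbrev L2Vec (D : Set (EuclideanSpace ℝ (Fin d))) : Type :=
  Lp (EuclideanSpace ℝ (Fin d)) 2 (volume.restrict D)

/-- The space `L^∞_+(D)` of all `a ∈ L^∞(D)` with positive essential infimum. -/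
def LInfPos (D : Set (EuclideanSpace ℝ (Fin d))) : Type :=
  {a : LInf D // ∃ ε : ℝ, 0 < ε ∧ ∀ᵐ x ∂(volume.restrict D), ε ≤ a x}

theorem memLp_log {D : Set (EuclideanSpace ℝ (Fin d))} (a : LInfPos D) :
    MemLp (fun x => Real.log (a.1 x)) ∞ (volume.restrict D) := by
  obtain ⟨a, ε, hε, ha⟩ := a
  have hm : AEStronglyMeasurable (fun x => Real.log (a x)) (volume.restrict D) :=
    (Real.measurable_log.comp_aemeasurable (Lp.aestronglyMeasurable a).aemeasurable).aestronglyMeasurable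
  refine memLp_top_of_bound hm (max |Real.log ε| |Real.log (‖a‖)|) ?_
  have hb : ∀ᵐ x ∂(volume.restrict D), ‖a x‖ ≤ ‖a‖ := by
    have h := ae_le_eLpNormEssSup (f := (a : EuclideanSpace ℝ (Fin d) → ℝ)) (μ := volume.restrict D)
    filter_upwards [h] with x hx
    rw [← eLpNorm_exponent_top] at hx
    rw [Lp.norm_def]
    have h2 := ENNReal.toReal_mono (Lp.eLpNorm_ne_top a) hx
    simpa using h2
  filter_upwards [ha, hb] with x h1 h2
  have h3 : a x ≤ ‖a‖ := (le_abs_self _).trans h2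
  have h4 : 0 < a x := hε.trans_le h1
  rw [Real.norm_eq_abs]
  exact abs_le_max_abs_abs (Real.log_le_log hε h1) (Real.log_le_log h4 h3)

/-- `log a ∈ L^∞(D)` for `a ∈ L^∞_+(D)`. -/
def LInfPos.log {D : Set (EuclideanSpace ℝ (Fin d))} (a : LInfPos D) : LInf D :=
  (memLp_log a).toLp

theorem LInfPos.log_injective {D : Set (EuclideanSpace ℝ (Fin d))} :
    Function.Injective (LInfPos.log (D := D)) := by
  intro a b h
  have h' := (MemLp.toLp_eq_toLp_iff (memLp_log a) (memLp_log b)).1 h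
  obtain ⟨a, ε, hε, ha⟩ := a
  obtain ⟨b, δ, hδ, hb⟩ := b
  refine Subtype.ext (Lp.ext ?_)
  filter_upwards [h', ha, hb] with x hx h1 h2
  exact Real.log_injOn_pos (hε.trans_le h1) (hδ.trans_le h2) hx

/-- The data space `L^∞_+(D) × L²(D)` of pairs (coefficient, source term). It is a separate type
so that it carries the metric below and not the maximum metric of a product. -/
def Data (D : Set (EuclideanSpace ℝ (Fin d))) : Type := LInfPos D × L2 D

/-- The diffusion coefficient `a` of the data `(a, f)`. -/
def Data.coeff {D : Set (EuclideanSpace ℝ (Fin d))} (x : Data D) : LInfPos D := x.1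

/-- The source term `f` of the data `(a, f)`. -/
def Data.source {D : Set (EuclideanSpace ℝ (Fin d))} (x : Data D) : L2 D := x.2

/-- The metric `‖log a₁ - log a₂‖_{L^∞(D)} + ‖f₁ - f₂‖_{L²(D)}`. -/
instance (D : Set (EuclideanSpace ℝ (Fin d))) : MetricSpace (Data D) where
  dist x y := ‖x.coeff.log - y.coeff.log‖ + ‖x.source - y.source‖
  dist_self x := by simp
  dist_comm x y := by rw [norm_sub_rev, norm_sub_rev x.source]
  dist_triangle x y z := by
    have h1 := norm_sub_le_norm_sub_add_norm_sub x.coeff.log y.coeff.log z.coeff.log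
    have h2 := norm_sub_le_norm_sub_add_norm_sub x.source y.source z.source
    linarith
  eq_of_dist_eq_zero := by
    intro x y h
    have h1 := norm_nonneg (x.coeff.log - y.coeff.log)
    have h2 := norm_nonneg (x.source - y.source)
    have h' : ‖x.coeff.log - y.coeff.log‖ + ‖x.source - y.source‖ = 0 := h
    have e1 : x.coeff.log = y.coeff.log := sub_eq_zero.1 (norm_eq_zero.1 (by linarith))
    have e2 : x.source = y.source := sub_eq_zero.1 (norm_eq_zero.1 (by linarith))
    exact Prod.ext (LInfPos.log_injective e1) e2

instance (D : Set (EuclideanSpace ℝ (Fin d))) : MeasurableSpace (Data D) := borel _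

instance (D : Set (EuclideanSpace ℝ (Fin d))) : BorelSpace (Data D) := ⟨rfl⟩

/-- `φ ∈ C_c^∞(D)`. -/
def IsTestFunction (D : Set (EuclideanSpace ℝ (Fin d))) (φ : EuclideanSpace ℝ (Fin d) → ℝ) : Prop :=
  ContDiff ℝ ∞ φ ∧ HasCompactSupport φ ∧ tsupport φ ⊆ D

/-- The subspace of all pairs `(φ, ∇φ)`, `φ ∈ C_c^∞(D)`, in `L²(D) × L²(D; ℝ^d)`. -/
def testGraph (D : Set (EuclideanSpace ℝ (Fin d))) : Submodule ℝ (L2 D × L2Vec D) where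
  carrier := {z | ∃ φ, IsTestFunction D φ ∧
    z.1 =ᵐ[volume.restrict D] φ ∧ z.2 =ᵐ[volume.restrict D] gradient φ}
  zero_mem' := by
    refine ⟨0, ⟨contDiff_const, HasCompactSupport.zero, by simp [tsupport]⟩, Lp.coeFn_zero _ _ _, ?_⟩
    have : gradient (0 : EuclideanSpace ℝ (Fin d) → ℝ) = 0 := by
      ext1 x; simp [gradient]
    rw [this]
    exact Lp.coeFn_zero _ _ _
  add_mem' := by
    rintro z w ⟨φ, ⟨h1, h2, h3⟩, h4, h5⟩ ⟨ψ, ⟨k1, k2, k3⟩, k4, k5⟩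
    refine ⟨φ + ψ, ⟨h1.add k1, h2.add k2, ?_⟩, ?_, ?_⟩
    · exact (tsupport_add φ ψ).trans (union_subset h3 k3)
    · exact (Lp.coeFn_add _ _).trans (h4.add k4)
    · have : gradient (φ + ψ) = gradient φ + gradient ψ := by
        ext1 x
        simp only [gradient, Pi.add_apply]
        rw [fderiv_add (h1.differentiable (by simp) x) (k1.differentiable (by simp) x), map_add]
      rw [this]
      exact (Lp.coeFn_add _ _).trans (h5.add k5)
  smul_mem' := by
    rintro c z ⟨φ, ⟨h1, h2, h3⟩, h4, h5⟩
    refine ⟨c • φ, ⟨h1.const_smul c, h2.smul_left (f := fun _ => c), ?_⟩, ?_, ?_⟩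
    · exact (closure_mono (Function.support_const_smul_subset c φ)).trans h3
    · exact (Lp.coeFn_smul _ _).trans (h4.const_smul c)
    · have : gradient (c • φ) = c • gradient φ := by
        ext1 x
        simp only [gradient, Pi.smul_apply]
        rw [fderiv_const_smul (h1.differentiable (by simp) x), map_smulₛₗ]
        simp
      rw [this]
      exact (Lp.coeFn_smul _ _).trans (h5.const_smul c)

/-- `H_0^1(D)`, the closure of `C_c^∞(D)` in the `H^1`-norm. An element is recorded as the pair
`(u, ∇u)` of a function in `L²(D)` and its (uniquely determined) weak gradient in `L²(D; ℝ^d)`. -/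
def H01 (D : Set (EuclideanSpace ℝ (Fin d))) : Type := (testGraph D).topologicalClosure

instance (D : Set (EuclideanSpace ℝ (Fin d))) : AddCommGroup (H01 D) :=
  inferInstanceAs (AddCommGroup (testGraph D).topologicalClosure)

/-- The function `u ∈ L²(D)` underlying `u ∈ H_0^1(D)`. -/
def H01.toL2 {D : Set (EuclideanSpace ℝ (Fin d))} (u : H01 D) : L2 D := u.1.1

/-- The weak gradient `∇u ∈ L²(D; ℝ^d)` of `u ∈ H_0^1(D)`. -/
def H01.grad {D : Set (EuclideanSpace ℝ (Fin d))} : H01 D →+ L2Vec D where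
  toFun u := u.1.2
  map_zero' := rfl
  map_add' _ _ := rfl

/-- The norm `‖u‖_{H_0^1(D)} = ‖∇u‖_{L²(D)}` (a seminorm on sets `D` without Poincaré
inequality). -/
instance (D : Set (EuclideanSpace ℝ (Fin d))) : SeminormedAddCommGroup (H01 D) :=
  SeminormedAddCommGroup.induced (H01 D) (L2Vec D) H01.grad

instance (D : Set (EuclideanSpace ℝ (Fin d))) : MeasurableSpace (H01 D) := borel _

instance (D : Set (EuclideanSpace ℝ (Fin d))) : BorelSpace (H01 D) := ⟨rfl⟩

/-- The Poincaré constant of `D`: the least `c ≥ 0` with `‖v‖_{L²} ≤ c ‖∇v‖_{L²}` on `H_0^1(D)`. -/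
def poincareConst (D : Set (EuclideanSpace ℝ (Fin d))) : ℝ :=
  sInf {c : ℝ | 0 ≤ c ∧ ∀ v : H01 D, ‖v.toL2‖ ≤ c * ‖v.grad‖}

/-! ### The elliptic problem -/

/-- `u ∈ H_0^1(D)` is the weak solution of `-∇·(a ∇u) = f` for the data `x = (a, f)`. -/
def IsWeakSolution {D : Set (EuclideanSpace ℝ (Fin d))} (x : Data D) (u : H01 D) : Prop :=
  ∀ v : H01 D,
    ∫ y in D, x.coeff.1 y * inner ℝ (u.grad y) (v.grad y) = ∫ y in D, x.source y * v.toL2 y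

/-- The solution operator `S : L^∞_+(D) × L²(D) → H_0^1(D)`. -/
def solution {D : Set (EuclideanSpace ℝ (Fin d))} (x : Data D) : H01 D :=
  Classical.epsilon (fun u : H01 D => IsWeakSolution x u)

end EllipticUQ

end

open EllipticUQ

/-!
The gradient norm makes `H_0^1(D)` a Hilbert space by the Poincaré inequality, which follows from
integrating `φ² · ∂₀(x₀)` by parts for a test function `φ`. Existence of weak solutions is then the
Lax–Milgram theorem, and testing the equation with the solution gives the a priori bound.

Testing the difference of two weak formulations with the difference of the solutions gives
`‖S x - S y‖ ≤ e^{‖log a_x‖} (c ‖f_x - f_y‖ + ‖a_x - a_y‖_∞ ‖∇ S y‖)`. Up to exchanging the two data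
one may assume `‖log a_x‖ ≤ ‖log a_y‖`, and then the right side is at most `c h(y) d(x, y)` with the
weight `h = (1 + ‖f‖) exp (3 ‖log a‖)` (`dist_solution_le_of_norm_log_le`). So `S` is locally
Lipschitz with constant `c max (h x) (h y)`; in particular it is continuous, hence Borel measurable.

As `S` is continuous, the map `(x, y) ↦ (S x, S y)` is measurable for the Borel σ-algebras of the
product spaces, and every coupling of `P` and `Q` has an image coupling of `S_* P` and `S_* Q`
(`IsCoupling.map`); separability of the data space is not needed. Integrating the Lipschitz estimate
over a coupling with Hölder's inequality splits the `p`-th moment into the `2p`-th moment of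
`max (h x) (h y)`, which is at most `∫ h^{2p} dP + ∫ h^{2p} dQ ≤ 2 C`, and that of `d(x, y)`
(`wasserstein_map_le`).
-/

namespace EllipticUQ

variable {d : ℕ} {D : Set (EuclideanSpace ℝ (Fin d))}

/-! ### The Poincaré inequality -/

/-- The Poincaré inequality in integral form. It comes from integrating `φ² · ∂₀(x₀)` by parts,
which gives `∫ φ² = - ∫ 2 φ (∂₀ φ) x₀`, and Young's inequality. -/
theorem IsTestFunction.integral_sq_le {φ : EuclideanSpace ℝ (Fin d) → ℝ} (hd : 0 < d)
    (hφ : IsTestFunction D φ) {R : ℝ} (hR : ∀ x ∈ D, ‖x‖ ≤ R) :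
    ∫ x in D, φ x ^ 2 ≤ (2 * R) ^ 2 * ∫ x in D, ‖gradient φ x‖ ^ 2 := by
  obtain ⟨hs, hc, hD⟩ := hφ
  have hdiff : Differentiable ℝ φ := hs.differentiable (by simp)
  have hcont : Continuous φ := hs.continuous
  have hfc : Continuous (fderiv ℝ φ) := hs.continuous_fderiv (by simp)
  have hnorm : ∀ x, ‖gradient φ x‖ = ‖fderiv ℝ φ x‖ := fun x => by simp [gradient]
  have hφ0 : ∀ x ∉ D, φ x = 0 := fun x hx => image_eq_zero_of_notMem_tsupport fun h => hx (hD h)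
  have hg0 : ∀ x ∉ D, fderiv ℝ φ x = 0 := fun x hx => by
    by_contra h
    exact hx (hD (support_fderiv_subset ℝ h))
  simp only [hnorm]
  rw [setIntegral_eq_integral_of_forall_compl_eq_zero (fun x hx => by simp [hφ0 x hx]),
    setIntegral_eq_integral_of_forall_compl_eq_zero (fun x hx => by simp [hg0 x hx])]
  have hc1 : HasCompactSupport (fun x => φ x ^ 2) :=
    hc.comp_left (g := fun y : ℝ => y ^ 2) (by simp)
  have hc2 : HasCompactSupport (fun x => ‖fderiv ℝ φ x‖ ^ 2) :=
    (hc.fderiv ℝ).comp_left (g := fun y => ‖y‖ ^ 2) (by simp)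
  have hi1 : Integrable (fun x => φ x ^ 2) :=
    Continuous.integrable_of_hasCompactSupport (by fun_prop) hc1
  have hi2 : Integrable (fun x => ‖fderiv ℝ φ x‖ ^ 2) :=
    Continuous.integrable_of_hasCompactSupport (by fun_prop) hc2
  let i₀ : Fin d := ⟨0, hd⟩
  let e : EuclideanSpace ℝ (Fin d) := EuclideanSpace.single i₀ 1
  let l : EuclideanSpace ℝ (Fin d) →L[ℝ] ℝ := EuclideanSpace.proj i₀
  have hle : l e = 1 := by simp [l, e]
  have hl : ∀ x, |l x| ≤ ‖x‖ := fun x => by simpa [l] using PiLp.norm_apply_le x i₀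
  have hne : ‖e‖ = 1 := by simp [e]
  have hsq : ∀ x, fderiv ℝ (fun x => φ x ^ 2) x e = 2 * φ x * fderiv ℝ φ x e := fun x => by
    rw [fderiv_fun_pow 2 (hdiff x)]
    simp
  have hi3 : Integrable (fun x => 2 * φ x * fderiv ℝ φ x e * l x) := by
    have hc3 : HasCompactSupport (fun x => 2 * φ x * fderiv ℝ φ x e * l x) :=
      HasCompactSupport.mul_right (HasCompactSupport.mul_right (HasCompactSupport.mul_left hc))
    have h : Continuous fun x => fderiv ℝ φ x e := hfc.clm_apply continuous_const
    exact Continuous.integrable_of_hasCompactSupport (by fun_prop) hc3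
  have hi4 : Integrable (fun x => φ x ^ 2 * l x) := by
    have hc4 : HasCompactSupport (fun x => φ x ^ 2 * l x) := HasCompactSupport.mul_right hc1
    exact Continuous.integrable_of_hasCompactSupport (by fun_prop) hc4
  have key : ∫ x, φ x ^ 2 = - ∫ x, 2 * φ x * fderiv ℝ φ x e * l x := by
    have h := integral_mul_fderiv_eq_neg_fderiv_mul_of_integrable (μ := volume) (𝕜 := ℝ)
      (f := fun x => φ x ^ 2) (g := l) (v := e)
      (by simpa only [hsq] using hi3) (by simpa [hle] using hi1) hi4
      (fun x _ => (hdiff x).pow 2) (fun x _ => l.differentiableAt)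
    simpa only [hsq, ContinuousLinearMap.fderiv, hle, mul_one] using h
  have hpt : ∀ x, -(2 * φ x * fderiv ℝ φ x e * l x) ≤
      1 / 2 * φ x ^ 2 + 2 * R ^ 2 * ‖fderiv ℝ φ x‖ ^ 2 := fun x => by
    by_cases hx : x ∈ D
    · have h1 : |fderiv ℝ φ x e| ≤ ‖fderiv ℝ φ x‖ := by
        simpa [hne] using (fderiv ℝ φ x).le_opNorm e
      have h2 : |fderiv ℝ φ x e * l x| ≤ ‖fderiv ℝ φ x‖ * R := by
        rw [abs_mul]
        exact mul_le_mul h1 ((hl x).trans (hR x hx)) (abs_nonneg _) (norm_nonneg _)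
      have h3 := sq_le_sq' (neg_le_of_abs_le h2) (le_of_abs_le h2)
      nlinarith [sq_nonneg (φ x + 2 * (fderiv ℝ φ x e * l x))]
    · simp [hφ0 x hx, hg0 x hx]
  have hint := integral_mono hi3.neg ((hi1.const_mul (1 / 2)).add (hi2.const_mul (2 * R ^ 2))) hpt
  simp only [Pi.neg_apply, Pi.add_apply] at hint
  rw [integral_neg, ← key, integral_add (hi1.const_mul _) (hi2.const_mul _), integral_const_mul,
    integral_const_mul] at hint
  linarith

theorem norm_sq_eq_integral {E : Type*} [NormedAddCommGroup E] [InnerProductSpace ℝ E]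
    {α : Type*} [MeasurableSpace α] {μ : Measure α} (f : Lp E 2 μ) {g : α → E} (h : f =ᵐ[μ] g) :
    ‖f‖ ^ 2 = ∫ x, ‖g x‖ ^ 2 ∂μ := by
  rw [← real_inner_self_eq_norm_sq, L2.inner_def]
  refine integral_congr_ae ?_
  filter_upwards [h] with x hx
  rw [hx, real_inner_self_eq_norm_sq]

/-- The Poincaré inequality passes from test functions to their closure `H_0^1(D)`. -/
theorem norm_fst_le_of_mem_closure (hd : 0 < d) {R : ℝ} (hR0 : 0 ≤ R) (hR : ∀ x ∈ D, ‖x‖ ≤ R)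
    {z : L2 D × L2Vec D} (hz : z ∈ (testGraph D).topologicalClosure) :
    ‖z.1‖ ≤ 2 * R * ‖z.2‖ := by
  have hcl : IsClosed {z : L2 D × L2Vec D | ‖z.1‖ ≤ 2 * R * ‖z.2‖} :=
    isClosed_le (by fun_prop) (by fun_prop)
  refine closure_minimal (s := (testGraph D : Set (L2 D × L2Vec D))) ?_ hcl hz
  rintro w ⟨φ, hφ, h1, h2⟩
  have h := hφ.integral_sq_le hd hR
  rw [norm_sq_eq_integral w.2 h2 |>.symm] at h
  have h3 : ‖w.1‖ ^ 2 = ∫ x in D, φ x ^ 2 := by simpa using norm_sq_eq_integral w.1 h1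
  rw [← h3, ← mul_pow] at h
  exact (pow_le_pow_iff_left₀ (norm_nonneg _) (by positivity) two_ne_zero).1 h


theorem H01.norm_eq (v : H01 D) : ‖v‖ = ‖v.grad‖ := rfl

theorem H01.ext {u v : H01 D} (h₁ : u.toL2 = v.toL2) (h₂ : u.grad = v.grad) : u = v :=
  Subtype.ext (Prod.ext h₁ h₂)

theorem poincareConst_nonneg : 0 ≤ poincareConst D := Real.sInf_nonneg fun _ h => h.1

/-- On a bounded set the Poincaré constant is itself admissible in the Poincaré inequality: the
set of admissible constants is nonempty and closed. -/
theorem H01.norm_toL2_le (hd : 0 < d) (hD : Bornology.IsBounded D) (v : H01 D) :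
    ‖v.toL2‖ ≤ poincareConst D * ‖v‖ := by
  obtain ⟨R, hR0, hR⟩ := hD.exists_pos_norm_le
  have hcl : IsClosed {c : ℝ | 0 ≤ c ∧ ∀ v : H01 D, ‖v.toL2‖ ≤ c * ‖v.grad‖} := by
    simp only [ofPred_and, ofPred_forall]
    exact (isClosed_le continuous_const continuous_id).inter
      (isClosed_iInter fun v => isClosed_le continuous_const (by fun_prop))
  have hne : {c : ℝ | 0 ≤ c ∧ ∀ v : H01 D, ‖v.toL2‖ ≤ c * ‖v.grad‖}.Nonempty :=
    ⟨2 * R, by positivity, fun v => norm_fst_le_of_mem_closure hd hR0.le hR v.2⟩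
  exact (hcl.csInf_mem hne ⟨0, fun _ h => h.1⟩).2 v

/-! ### Multiplication by a coefficient -/

/-- Multiplication by `a ∈ L^∞(D)` as a bounded operator on `L²(D; ℝ^d)`. -/
noncomputable def coeffMul (a : LInf D) : L2Vec D →L[ℝ] L2Vec D :=
  (ContinuousLinearMap.lsmul ℝ ℝ).holderL (volume.restrict D) ∞ 2 2 a

theorem coeFn_coeffMul (a : LInf D) (g : L2Vec D) :
    coeffMul a g =ᵐ[volume.restrict D] fun y => a y • g y :=
  ContinuousLinearMap.coeFn_holder _ a g

theorem inner_coeffMul (a : LInf D) (g h : L2Vec D) :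
    inner ℝ (coeffMul a g) h = ∫ y in D, a y * inner ℝ (g y) (h y) := by
  rw [L2.inner_def]
  refine integral_congr_ae ?_
  filter_upwards [coeFn_coeffMul a g] with y hy
  rw [hy, real_inner_smul_left]

theorem isWeakSolution_iff (x : Data D) (u : H01 D) :
    IsWeakSolution x u ↔
      ∀ v : H01 D, inner ℝ (coeffMul x.coeff.1 u.grad) v.grad = inner ℝ x.source v.toL2 := by
  refine forall_congr' fun v => ?_
  rw [inner_coeffMul, L2.inner_def]
  simp only [Real.inner_apply]

theorem coercive_coeffMul {a : LInf D} {α : ℝ} (ha : ∀ᵐ y ∂(volume.restrict D), α ≤ a y)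
    (g : L2Vec D) : α * ‖g‖ ^ 2 ≤ inner ℝ (coeffMul a g) g := by
  rw [norm_sq_eq_integral g (ae_eq_refl _), L2.inner_def, ← integral_const_mul]
  refine integral_mono_ae ?_ (L2.integrable_inner _ _) ?_
  · have h := (L2.integrable_inner (𝕜 := ℝ) g g).const_mul α
    simpa only [real_inner_self_eq_norm_sq] using h
  · filter_upwards [ha, coeFn_coeffMul a g] with y hy hm
    rw [hm, real_inner_smul_left, real_inner_self_eq_norm_sq]
    gcongr

theorem norm_coeffMul_sub_le {a b : LInf D} {K : ℝ}
    (h : ∀ᵐ y ∂(volume.restrict D), |a y - b y| ≤ K) (g : L2Vec D) :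
    ‖coeffMul a g - coeffMul b g‖ ≤ K * ‖g‖ := by
  refine Lp.norm_le_mul_norm_of_ae_le_mul ?_
  filter_upwards [h, coeFn_coeffMul a g, coeFn_coeffMul b g,
    Lp.coeFn_sub (coeffMul a g) (coeffMul b g)] with y hy h1 h2 h3
  rw [h3, Pi.sub_apply, h1, h2, ← sub_smul, norm_smul, Real.norm_eq_abs]
  gcongr

/-! ### Pointwise bounds by the logarithm of the coefficient -/

theorem ae_abs_le_norm (f : LInf D) : ∀ᵐ y ∂(volume.restrict D), |f y| ≤ ‖f‖ := by
  filter_upwards [ae_le_eLpNormEssSup (f := (f : EuclideanSpace ℝ (Fin d) → ℝ))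
    (μ := volume.restrict D)] with y hy
  rw [← eLpNorm_exponent_top] at hy
  simpa [Lp.norm_def] using ENNReal.toReal_mono (Lp.eLpNorm_ne_top f) hy

theorem LInfPos.ae_eq_exp_log (a : LInfPos D) :
    ∀ᵐ y ∂(volume.restrict D), a.1 y = Real.exp (a.log y) := by
  obtain ⟨ε, hε, ha⟩ := a.2
  filter_upwards [ha, (memLp_log a).coeFn_toLp] with y h1 h2
  rw [LInfPos.log, h2, Real.exp_log (hε.trans_le h1)]

theorem LInfPos.ae_exp_neg_le (a : LInfPos D) :
    ∀ᵐ y ∂(volume.restrict D), Real.exp (-‖a.log‖) ≤ a.1 y := by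
  filter_upwards [a.ae_eq_exp_log, ae_abs_le_norm a.log] with y h1 h2
  rw [h1]
  exact Real.exp_le_exp.2 (neg_le_of_abs_le h2)

theorem abs_exp_sub_exp_le {s t M : ℝ} (hs : s ≤ M) (ht : t ≤ M) :
    |Real.exp s - Real.exp t| ≤ Real.exp M * |s - t| := by
  wlog hst : t ≤ s generalizing s t
  · rw [abs_sub_comm, abs_sub_comm s]
    exact this ht hs (le_of_not_ge hst)
  rw [abs_of_nonneg (sub_nonneg.2 (Real.exp_le_exp.2 hst)), abs_of_nonneg (sub_nonneg.2 hst)]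
  have h1 : Real.exp s - Real.exp t = Real.exp s * (1 - Real.exp (t - s)) := by
    rw [mul_sub, ← Real.exp_add]; ring_nf
  rw [h1]
  have h2 := Real.add_one_le_exp (t - s)
  exact mul_le_mul (Real.exp_le_exp.2 hs) (by linarith)
    (sub_nonneg.2 (Real.exp_le_one_iff.2 (by linarith))) (Real.exp_nonneg M)

theorem LInfPos.ae_abs_sub_le (a b : LInfPos D) (h : ‖a.log‖ ≤ ‖b.log‖) :
    ∀ᵐ y ∂(volume.restrict D),
      |a.1 y - b.1 y| ≤ Real.exp ‖b.log‖ * ‖a.log - b.log‖ := by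
  filter_upwards [a.ae_eq_exp_log, b.ae_eq_exp_log, ae_abs_le_norm a.log, ae_abs_le_norm b.log,
    ae_abs_le_norm (a.log - b.log), Lp.coeFn_sub a.log b.log] with y h1 h2 h3 h4 h5 h6
  rw [h1, h2]
  rw [h6, Pi.sub_apply] at h5
  refine (abs_exp_sub_exp_le ((le_of_abs_le h3).trans h) (le_of_abs_le h4)).trans ?_
  gcongr

/-! ### Well-posedness -/

/-- Existence by the Lax–Milgram theorem. Since `‖∇·‖` is the norm, it is applied in the space of
gradients, a closed subspace of `L²(D; ℝ^d)` by the Poincaré inequality. -/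
theorem exists_isWeakSolution (hd : 0 < d) (hD : Bornology.IsBounded D) (x : Data D) :
    ∃ u : H01 D, IsWeakSolution x u := by
  let K := (testGraph D).topologicalClosure
  have : CompleteSpace K := (testGraph D).isClosed_topologicalClosure.completeSpace_coe
  let T : K →L[ℝ] L2Vec D := (ContinuousLinearMap.snd ℝ _ _).comp K.subtypeL
  have hT : AntilipschitzWith (Real.toNNReal (max (poincareConst D) 1)) T := by
    refine T.antilipschitz_of_bound fun v => ?_
    rw [Real.coe_toNNReal _ (zero_le_one.trans (le_max_right _ _))]
    refine max_le ?_ ?_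
    · exact (H01.norm_toL2_le hd hD v).trans
        (mul_le_mul_of_nonneg_right (le_max_left _ _) (norm_nonneg _))
    · exact le_mul_of_one_le_left (norm_nonneg _) (le_max_right _ _)
  have hcl : IsClosed (range T) := hT.isClosed_range T.uniformContinuous
  let e := ContinuousLinearMap.equivRange hT.injective hcl
  let G := (T : K →ₗ[ℝ] L2Vec D).range
  have hG : IsClosed (G : Set (L2Vec D)) := hcl
  have : CompleteSpace G := hG.completeSpace_coe
  let B : G →L[ℝ] G →L[ℝ] ℝ :=
    (innerSL ℝ (E := L2Vec D)).bilinearComp ((coeffMul x.coeff.1).comp G.subtypeL) G.subtypeL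
  have hB : IsCoercive B := by
    obtain ⟨ε, hε, ha⟩ := x.coeff.2
    refine ⟨ε, hε, fun g => ?_⟩
    rw [mul_assoc, ← sq]
    exact coercive_coeffMul ha g.1
  let l : G →L[ℝ] ℝ := (innerSL ℝ (E := L2 D) x.source).comp
    ((ContinuousLinearMap.fst ℝ _ _).comp (K.subtypeL.comp (e.symm : G →L[ℝ] K)))
  let g : G := hB.continuousLinearEquivOfBilin.symm ((InnerProductSpace.toDual ℝ G).symm l)
  have hg : ∀ v : K, B g (e v) = l (e v) := fun v => by
    rw [← hB.continuousLinearEquivOfBilin_apply, ContinuousLinearEquiv.apply_symm_apply,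
      InnerProductSpace.toDual_symm_apply]
  have hl : ∀ v : K, l (e v) = inner ℝ x.source v.1.1 := fun v => by
    change inner ℝ x.source (e.symm (e v)).1.1 = _
    rw [e.symm_apply_apply]
  obtain ⟨u, hu⟩ := e.surjective g
  refine ⟨u, (isWeakSolution_iff x u).2 fun v => ?_⟩
  have h := hg v
  rw [← hu] at h
  exact h.trans (hl v)

theorem isWeakSolution_solution (hd : 0 < d) (hD : Bornology.IsBounded D) (x : Data D) :
    IsWeakSolution x (solution x) :=
  Classical.epsilon_spec (exists_isWeakSolution hd hD x)

theorem IsWeakSolution.unique (hd : 0 < d) (hD : Bornology.IsBounded D) {x : Data D}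
    {u w : H01 D} (hu : IsWeakSolution x u) (hw : IsWeakSolution x w) : u = w := by
  rw [isWeakSolution_iff] at hu hw
  obtain ⟨ε, hε, ha⟩ := x.coeff.2
  have h1 := coercive_coeffMul ha (u - w).grad
  have h2 : inner ℝ (coeffMul x.coeff.1 (u - w).grad) (u - w).grad = 0 := by
    conv_lhs => rw [map_sub H01.grad u w, map_sub, inner_sub_left, ← map_sub H01.grad u w]
    rw [hu, hw, sub_self]
  have h3 : ‖u - w‖ = 0 := by
    rw [h2] at h1
    have h4 : ‖(u - w).grad‖ ^ 2 ≤ 0 := nonpos_of_mul_nonpos_right h1 hε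
    exact pow_eq_zero_iff two_ne_zero |>.1 (le_antisymm h4 (sq_nonneg _))
  have h4 : ‖(u - w).toL2‖ ≤ 0 := by simpa [h3] using H01.norm_toL2_le hd hD (u - w)
  refine H01.ext (sub_eq_zero.1 (norm_le_zero_iff.1 h4)) ?_
  rw [H01.norm_eq, map_sub] at h3
  exact sub_eq_zero.1 (norm_eq_zero.1 h3)

theorem norm_solution_le (hd : 0 < d) (hD : Bornology.IsBounded D) (x : Data D) {α : ℝ}
    (hα : 0 < α) (ha : ∀ᵐ y ∂(volume.restrict D), α ≤ x.coeff.1 y) :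
    ‖solution x‖ ≤ poincareConst D / α * ‖x.source‖ := by
  set u := solution x with hu
  have h1 := coercive_coeffMul ha u.grad
  rw [(isWeakSolution_iff x u).1 (isWeakSolution_solution hd hD x) u] at h1
  have h2 := (h1.trans (real_inner_le_norm _ _)).trans
    (mul_le_mul_of_nonneg_left (H01.norm_toL2_le hd hD u) (norm_nonneg _))
  rw [← H01.norm_eq] at h2
  rw [div_mul_eq_mul_div, le_div_iff₀ hα]
  rcases (norm_nonneg u).eq_or_lt with h | h
  · rw [← h, zero_mul]
    exact mul_nonneg poincareConst_nonneg (norm_nonneg _)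
  · refine le_of_mul_le_mul_right ?_ h
    linarith

/-! ### Sensitivity of the solution -/

/-- The local Lipschitz weight `(1 + ‖f‖) exp (3 ‖log a‖)` of the solution operator. -/
noncomputable def Data.weight (x : Data D) : ℝ := (1 + ‖x.source‖) * Real.exp (3 * ‖x.coeff.log‖)

theorem Data.dist_eq (x y : Data D) :
    dist x y = ‖x.coeff.log - y.coeff.log‖ + ‖x.source - y.source‖ := rfl

theorem Data.one_le_weight (x : Data D) : 1 ≤ x.weight :=
  one_le_mul_of_one_le_of_one_le (by linarith [norm_nonneg x.source])
    (Real.one_le_exp (by positivity))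

theorem norm_solution_le_weight (hd : 0 < d) (hD : Bornology.IsBounded D) (x : Data D) :
    ‖solution x‖ ≤ poincareConst D * x.weight := by
  refine (norm_solution_le hd hD x (Real.exp_pos _) x.coeff.ae_exp_neg_le).trans ?_
  rw [Real.exp_neg, div_inv_eq_mul, mul_assoc, mul_comm (Real.exp _)]
  refine mul_le_mul_of_nonneg_left ?_ poincareConst_nonneg
  refine mul_le_mul (by linarith) (Real.exp_le_exp.2 ?_) (by positivity) (by positivity)
  linarith [norm_nonneg x.coeff.log]

/-- The stability estimate, in terms of the weight of the data with the larger `‖log a‖`. The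
difference of the two weak formulations is tested with the difference of the solutions. -/
theorem dist_solution_le_of_norm_log_le (hd : 0 < d) (hD : Bornology.IsBounded D) {x y : Data D}
    (hxy : ‖x.coeff.log‖ ≤ ‖y.coeff.log‖) :
    dist (solution x) (solution y) ≤ poincareConst D * y.weight * dist x y := by
  set c := poincareConst D
  have hc : 0 ≤ c := poincareConst_nonneg
  set u := solution x
  set w := solution y
  set L := ‖y.coeff.log‖ with hL
  have hu := (isWeakSolution_iff x u).1 (isWeakSolution_solution hd hD x) (u - w)
  have hw := (isWeakSolution_iff y w).1 (isWeakSolution_solution hd hD y) (u - w)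
  have hx : ∀ᵐ z ∂(volume.restrict D), Real.exp (-L) ≤ x.coeff.1 z := by
    filter_upwards [x.coeff.ae_exp_neg_le] with z hz
    exact (Real.exp_le_exp.2 (neg_le_neg hxy)).trans hz
  have h1 := coercive_coeffMul hx (u - w).grad
  have h2 : inner ℝ (coeffMul x.coeff.1 (u - w).grad) (u - w).grad =
      inner ℝ (x.source - y.source) (u - w).toL2 -
        inner ℝ (coeffMul x.coeff.1 w.grad - coeffMul y.coeff.1 w.grad) (u - w).grad := by
    rw [inner_sub_left, inner_sub_left, ← hu, ← hw]
    conv_lhs => rw [map_sub H01.grad u w, map_sub, inner_sub_left, ← map_sub H01.grad u w]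
    ring
  have h3 : inner ℝ (x.source - y.source) (u - w).toL2 ≤
      ‖x.source - y.source‖ * (c * ‖u - w‖) :=
    (real_inner_le_norm _ _).trans
      (mul_le_mul_of_nonneg_left (H01.norm_toL2_le hd hD (u - w)) (norm_nonneg _))
  have h4 := neg_le_of_abs_le (abs_real_inner_le_norm
    (coeffMul x.coeff.1 w.grad - coeffMul y.coeff.1 w.grad) (u - w).grad)
  have h5 := norm_coeffMul_sub_le (LInfPos.ae_abs_sub_le _ _ hxy) w.grad
  have h6 : ‖w‖ ≤ c * Real.exp L * ‖y.source‖ := by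
    have h := norm_solution_le hd hD y (Real.exp_pos _) y.coeff.ae_exp_neg_le
    rwa [Real.exp_neg, div_inv_eq_mul] at h
  rw [← H01.norm_eq] at h1 h4 h5
  have h7 := mul_le_mul_of_nonneg_right h5 (norm_nonneg (u - w))
  rw [dist_eq_norm, Data.dist_eq]
  set n := ‖u - w‖
  set δ := ‖x.coeff.log - y.coeff.log‖
  set η := ‖x.source - y.source‖
  have hδ : 0 ≤ δ := norm_nonneg _
  have hη : 0 ≤ η := norm_nonneg _
  have hn : 0 ≤ n := norm_nonneg _
  set F := ‖y.source‖
  have hF : 0 ≤ F := norm_nonneg _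
  set A := Real.exp L with hA
  have hA1 : 1 ≤ A := Real.one_le_exp (norm_nonneg _)
  have h8 : Real.exp (-L) * n ≤ c * η + A * δ * (c * A * F) := by
    have h9 : A * δ * ‖w‖ ≤ A * δ * (c * A * F) := by gcongr
    rcases hn.eq_or_lt with h | h
    · rw [← h, mul_zero]
      positivity
    · refine le_of_mul_le_mul_right ?_ h
      have h10 := mul_le_mul_of_nonneg_right h9 hn
      linarith
  have hw' : y.weight = (1 + F) * A ^ 3 := by
    rw [Data.weight, hA, ← Real.exp_nat_mul]
    norm_num
    rfl
  rw [Real.exp_neg, inv_mul_le_iff₀ (Real.exp_pos _)] at h8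
  rw [hw']
  have hA13 : A ≤ A ^ 3 := le_self_pow₀ hA1 (by norm_num)
  calc n ≤ A * (c * η + A * δ * (c * A * F)) := h8
    _ = c * (A * η) + c * (F * A ^ 3 * δ) := by ring
    _ ≤ c * ((1 + F) * A ^ 3 * η) + c * ((1 + F) * A ^ 3 * δ) := by
        gcongr
        · exact hA13.trans (le_mul_of_one_le_left (by positivity) (by linarith))
        · linarith
    _ = c * ((1 + F) * A ^ 3) * (δ + η) := by ring

theorem dist_solution_le (hd : 0 < d) (hD : Bornology.IsBounded D) (x y : Data D) :
    dist (solution x) (solution y) ≤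
      poincareConst D * max x.weight y.weight * dist x y := by
  have hc : 0 ≤ poincareConst D := poincareConst_nonneg
  rcases le_total ‖x.coeff.log‖ ‖y.coeff.log‖ with h | h
  · refine (dist_solution_le_of_norm_log_le hd hD h).trans ?_
    gcongr
    exact le_max_right _ _
  · rw [dist_comm, dist_comm x]
    refine (dist_solution_le_of_norm_log_le hd hD h).trans ?_
    gcongr
    exact le_max_left _ _

theorem Data.continuous_weight : Continuous (Data.weight (D := D)) := by
  have h1 : LipschitzWith 1 fun x : Data D => ‖x.source‖ :=
    LipschitzWith.of_dist_le_mul fun x y => by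
      rw [Data.dist_eq, NNReal.coe_one, one_mul, Real.dist_eq]
      linarith [abs_norm_sub_norm_le x.source y.source, norm_nonneg (x.coeff.log - y.coeff.log)]
  have h2 : LipschitzWith 1 fun x : Data D => ‖x.coeff.log‖ :=
    LipschitzWith.of_dist_le_mul fun x y => by
      rw [Data.dist_eq, NNReal.coe_one, one_mul, Real.dist_eq]
      linarith [abs_norm_sub_norm_le x.coeff.log y.coeff.log, norm_nonneg (x.source - y.source)]
  exact (continuous_const.add h1.continuous).mul
    (Real.continuous_exp.comp (continuous_const.mul h2.continuous))

theorem continuous_solution (hd : 0 < d) (hD : Bornology.IsBounded D) :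
    Continuous (solution (D := D)) := by
  refine continuous_iff_continuousAt.2 fun y => tendsto_iff_dist_tendsto_zero.2 ?_
  have hc : Continuous fun x : Data D =>
      poincareConst D * max x.weight y.weight * dist x y :=
    (continuous_const.mul (Data.continuous_weight.max continuous_const)).mul
      (continuous_id.dist continuous_const)
  exact squeeze_zero (fun _ => dist_nonneg) (fun x => dist_solution_le hd hD x y)
    (by simpa using hc.tendsto y)


/-! ### Couplings and the Wasserstein distance -/

section Coupling

theorem measurable_edist_rpow_borel {X : Type*} [PseudoMetricSpace X] (p : ℝ) :
    Measurable[borel (X × X)] fun z : X × X => edist z.1 z.2 ^ p := by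
  rw [BorelSpace.measurable_eq (α := ℝ≥0∞)]
  exact (ENNReal.continuous_rpow_const.comp continuous_edist).borel_measurable

variable {X Y : Type*} [PseudoMetricSpace X] [MeasurableSpace X] [BorelSpace X]
  [PseudoMetricSpace Y] [MeasurableSpace Y] [BorelSpace Y]

theorem measurable_fst_borel : Measurable[borel (X × X)] (Prod.fst : X × X → X) := by
  rw [BorelSpace.measurable_eq (α := X)]
  exact continuous_fst.borel_measurable

theorem measurable_snd_borel : Measurable[borel (X × X)] (Prod.snd : X × X → X) := by
  rw [BorelSpace.measurable_eq (α := X)]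
  exact continuous_snd.borel_measurable

theorem IsCoupling.map_fst {μ ν : Measure X} {π : @Measure (X × X) (borel (X × X))}
    (h : IsCoupling μ ν π) : @Measure.map _ _ (borel (X × X)) _ Prod.fst π = μ := by
  ext A hA
  rw [@Measure.map_apply _ _ (borel (X × X)) _ _ _ measurable_fst_borel _ hA, ← h.2.1 A hA,
    prod_univ]

theorem IsCoupling.map_snd {μ ν : Measure X} {π : @Measure (X × X) (borel (X × X))}
    (h : IsCoupling μ ν π) : @Measure.map _ _ (borel (X × X)) _ Prod.snd π = ν := by
  ext B hB
  rw [@Measure.map_apply _ _ (borel (X × X)) _ _ _ measurable_snd_borel _ hB, ← h.2.2 B hB,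
    univ_prod]

/-- The image of a coupling under a continuous map; the Borel σ-algebras of the product spaces
are respected because the map of pairs is again continuous. -/
theorem IsCoupling.map {μ ν : Measure X} {π : @Measure (X × X) (borel (X × X))}
    (h : IsCoupling μ ν π) {S : X → Y} (hS : Continuous S) :
    IsCoupling (μ.map S) (ν.map S)
      (@Measure.map _ _ (borel (X × X)) (borel (Y × Y)) (Prod.map S S) π) := by
  have hm : @Measurable _ _ (borel (X × X)) (borel (Y × Y)) (Prod.map S S) :=
    (hS.prodMap hS).borel_measurable
  refine ⟨?_, fun A hA => ?_, fun B hB => ?_⟩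
  · have := h.1
    exact @Measure.isProbabilityMeasure_map _ _ (borel (X × X)) (borel (Y × Y)) _ _ _
      (@Measurable.aemeasurable _ _ (borel (X × X)) (borel (Y × Y)) _ _ hm)
  · have hA' : MeasurableSet[borel (Y × Y)] (A ×ˢ (univ : Set Y)) := by
      rw [prod_univ]
      exact measurable_fst_borel hA
    rw [@Measure.map_apply _ _ (borel (X × X)) (borel (Y × Y)) _ _ hm _ hA',
      Measure.map_apply hS.measurable hA, ← h.2.1 _ (hS.measurable hA)]
    congr 1
  · have hB' : MeasurableSet[borel (Y × Y)] ((univ : Set Y) ×ˢ B) := by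
      rw [univ_prod]
      exact measurable_snd_borel hB
    rw [@Measure.map_apply _ _ (borel (X × X)) (borel (Y × Y)) _ _ hm _ hB',
      Measure.map_apply hS.measurable hB, ← h.2.2 _ (hS.measurable hB)]
    congr 1

/-- The diagonal coupling is optimal. -/
theorem wasserstein_self {p : ℝ} (hp : 0 < p) (μ : Measure X) [IsProbabilityMeasure μ] :
    wasserstein p μ μ = 0 := by
  have hm : @Measurable _ _ _ (borel (X × X)) (fun x : X => (x, x)) := by
    rw [BorelSpace.measurable_eq (α := X)]
    exact (continuous_id.prodMk continuous_id).borel_measurable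
  have hc : IsCoupling μ μ (@Measure.map _ _ _ (borel (X × X)) (fun x : X => (x, x)) μ) := by
    refine ⟨?_, fun A hA => ?_, fun B hB => ?_⟩
    · exact @Measure.isProbabilityMeasure_map _ _ _ (borel (X × X)) _ _ _
        (@Measurable.aemeasurable _ _ _ (borel (X × X)) _ _ hm)
    · rw [@Measure.map_apply _ _ _ (borel (X × X)) _ _ hm]
      · congr 1
        ext z
        simp
      · rw [prod_univ]
        exact measurable_fst_borel hA
    · rw [@Measure.map_apply _ _ _ (borel (X × X)) _ _ hm]
      · congr 1
        ext z
        simp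
      · rw [univ_prod]
        exact measurable_snd_borel hB
  refine le_antisymm (iInf₂_le_of_le _ hc ?_) zero_le
  rw [@lintegral_map _ _ _ (borel (X × X)) _ _ _
    (measurable_edist_rpow_borel p) hm]
  simp [hp]

/-- Hölder's inequality with exponents `1/p = 1/(2p) + 1/(2p)` for the product of `max a b`
and `e`. -/
theorem lintegral_max_mul_le {Ω : Type*} [MeasurableSpace Ω] (π : Measure Ω) {p : ℝ} (hp : 0 < p)
    {c : ℝ≥0∞} {a b e s : Ω → ℝ≥0∞} (ha : Measurable a) (hb : Measurable b) (he : Measurable e)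
    (hs : ∀ z, s z ≤ c * max (a z) (b z) * e z) :
    (∫⁻ z, s z ^ p ∂π) ^ (1 / p) ≤
      c * (∫⁻ z, a z ^ (2 * p) ∂π + ∫⁻ z, b z ^ (2 * p) ∂π) ^ (1 / (2 * p)) *
        (∫⁻ z, e z ^ (2 * p) ∂π) ^ (1 / (2 * p)) := by
  have hm : Measurable fun z => max (a z) (b z) := ha.max hb
  have hle : ∫⁻ z, s z ^ p ∂π ≤ c ^ p * ∫⁻ z, (max (a z) (b z) * e z) ^ p ∂π := by
    rw [← lintegral_const_mul _
      (by fun_prop : Measurable fun z => (max (a z) (b z) * e z) ^ p)]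
    refine lintegral_mono fun z => ?_
    rw [← ENNReal.mul_rpow_of_nonneg _ _ hp.le, ← mul_assoc]
    exact ENNReal.rpow_le_rpow (hs z) hp.le
  have hmax : ∫⁻ z, max (a z) (b z) ^ (2 * p) ∂π ≤
      ∫⁻ z, a z ^ (2 * p) ∂π + ∫⁻ z, b z ^ (2 * p) ∂π := by
    rw [← lintegral_add_left (ha.pow_const _)]
    refine lintegral_mono fun z => ?_
    rcases max_choice (a z) (b z) with h | h <;> simp [h]
  have hh := ENNReal.lintegral_Lp_mul_le_Lq_mul_Lr hp (by linarith : p < 2 * p)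
    (by field_simp; norm_num : 1 / p = 1 / (2 * p) + 1 / (2 * p)) π hm.aemeasurable he.aemeasurable
  calc (∫⁻ z, s z ^ p ∂π) ^ (1 / p)
      ≤ (c ^ p * ∫⁻ z, (max (a z) (b z) * e z) ^ p ∂π) ^ (1 / p) :=
        ENNReal.rpow_le_rpow hle (by positivity)
    _ = c * (∫⁻ z, (max (a z) (b z) * e z) ^ p ∂π) ^ (1 / p) := by
        rw [ENNReal.mul_rpow_of_nonneg _ _ (by positivity), ← ENNReal.rpow_mul,
          mul_one_div_cancel hp.ne', ENNReal.rpow_one]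
    _ ≤ c * ((∫⁻ z, max (a z) (b z) ^ (2 * p) ∂π) ^ (1 / (2 * p)) *
          (∫⁻ z, e z ^ (2 * p) ∂π) ^ (1 / (2 * p))) := by
        gcongr
        exact hh
    _ ≤ _ := by
        rw [mul_assoc]
        gcongr

/-- A map that is Lipschitz up to a weight `h` is Lipschitz from the `2p`-Wasserstein to the
`p`-Wasserstein distance on measures with bounded `2p`-th moment of `h`. -/
theorem wasserstein_map_le {S : X → Y} (hS : Continuous S) {h : X → ℝ≥0∞} (hh : Measurable h)
    {c C : ℝ≥0∞} (hc0 : c ≠ 0) (hc : c ≠ ⊤) (hC0 : C ≠ 0) (hC : C ≠ ⊤)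
    (hL : ∀ x y, edist (S x) (S y) ≤ c * max (h x) (h y) * edist x y) {p : ℝ} (hp : 1 ≤ p)
    {P Q : Measure X} (hP : ∫⁻ x, h x ^ (2 * p) ∂P ≤ C) (hQ : ∫⁻ x, h x ^ (2 * p) ∂Q ≤ C) :
    wasserstein p (P.map S) (Q.map S) ≤ 2 * c * C ^ (1 / (2 * p)) * wasserstein (2 * p) P Q := by
  have hp0 : 0 < p := by linarith
  have hq : 0 ≤ 1 / (2 * p) := by positivity
  have hK0 : 2 * c * C ^ (1 / (2 * p)) ≠ 0 := by
    simp [hc0, ENNReal.rpow_eq_zero_iff, hC0, hC]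
  have hK : 2 * c * C ^ (1 / (2 * p)) ≠ ⊤ :=
    ENNReal.mul_ne_top (ENNReal.mul_ne_top (by simp) hc) (ENNReal.rpow_ne_top_of_nonneg hq hC)
  rw [wasserstein.eq_def (2 * p), ENNReal.mul_iInf_of_ne hK0 hK]
  refine le_iInf fun π => ?_
  rw [ENNReal.mul_iInf_of_ne hK0 hK]
  refine le_iInf fun hπ => (iInf₂_le _ (hπ.map hS)).trans ?_
  have hm : @Measurable _ _ (borel (X × X)) (borel (Y × Y)) (Prod.map S S) :=
    (hS.prodMap hS).borel_measurable
  rw [@lintegral_map _ _ (borel (X × X)) (borel (Y × Y)) _ _ _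
    (measurable_edist_rpow_borel p) hm]
  have he : Measurable[borel (X × X)] fun z : X × X => edist z.1 z.2 := by
    simpa using measurable_edist_rpow_borel (X := X) 1
  have h1 := @lintegral_max_mul_le (X × X) (borel (X × X)) π p hp0 c (fun z => h z.1)
    (fun z => h z.2) (fun z => edist z.1 z.2) (fun z => edist (S z.1) (S z.2))
    (hh.comp measurable_fst_borel) (hh.comp measurable_snd_borel) he
    (fun z => hL z.1 z.2)
  refine h1.trans ?_
  rw [← hπ.map_fst, @lintegral_map _ _ (borel (X × X)) _ _ _ _ (hh.pow_const _)
    measurable_fst_borel] at hP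
  rw [← hπ.map_snd, @lintegral_map _ _ (borel (X × X)) _ _ _ _ (hh.pow_const _)
    measurable_snd_borel] at hQ
  refine mul_le_mul' ?_ le_rfl
  have h2 : (2 : ℝ≥0∞) ^ (1 / (2 * p)) ≤ 2 := by
    refine (ENNReal.rpow_le_rpow_of_exponent_le one_le_two ?_).trans_eq (ENNReal.rpow_one 2)
    rw [div_le_one (by positivity)]
    linarith
  calc _ ≤ c * (2 * C) ^ (1 / (2 * p)) := by
        rw [two_mul C]
        exact mul_le_mul' le_rfl (ENNReal.rpow_le_rpow (add_le_add hP hQ) hq)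
    _ = 2 ^ (1 / (2 * p)) * c * C ^ (1 / (2 * p)) := by
        rw [ENNReal.mul_rpow_of_nonneg _ _ hq]
        ring
    _ ≤ 2 * c * C ^ (1 / (2 * p)) := by gcongr

end Coupling

/-! ### Moments -/

/-- The weight in the moment condition is the `2p`-th power of `Data.weight`. -/
theorem Data.ofReal_weight_rpow {p : ℝ} (hp : 0 ≤ p) (x : Data D) :
    ENNReal.ofReal x.weight ^ (2 * p) =
      ENNReal.ofReal ((1 + ‖x.source‖) ^ (2 * p) * Real.exp (6 * p * ‖x.coeff.log‖)) := by
  have h1 : 0 ≤ x.weight := zero_le_one.trans x.one_le_weight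
  rw [ENNReal.ofReal_rpow_of_nonneg h1 (by positivity), Data.weight,
    Real.mul_rpow (by positivity) (Real.exp_nonneg _), ← Real.exp_mul]
  congr 3
  ring

/-- The data `a = 1`, `f = 0`. -/
noncomputable def Data.base (D : Set (EuclideanSpace ℝ (Fin d))) : Data D :=
  (⟨(memLp_top_const (1 : ℝ)).toLp _, 1, one_pos, by
    filter_upwards [(memLp_top_const (μ := volume.restrict D) (1 : ℝ)).coeFn_toLp] with y hy
    rw [hy]⟩, 0)

theorem Data.base_log : (Data.base D).coeff.log = 0 := by
  refine Lp.ext ?_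
  filter_upwards [(memLp_log (Data.base D).coeff).coeFn_toLp, Lp.coeFn_zero ℝ ∞ (volume.restrict D),
    (memLp_top_const (μ := volume.restrict D) (1 : ℝ)).coeFn_toLp] with y h1 h2 h3
  have h4 : (Data.base D).coeff.1 y = 1 := h3
  rw [LInfPos.log, h1, h2, h4, Real.log_one, Pi.zero_apply]

theorem Data.dist_base_le (x : Data D) : dist x (Data.base D) ≤ x.weight := by
  rw [Data.dist_eq, Data.base_log, sub_zero, show (Data.base D).source = 0 from rfl, sub_zero,
    Data.weight]
  have h1 := Real.add_one_le_exp (3 * ‖x.coeff.log‖)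
  have h2 := norm_nonneg x.coeff.log
  have h3 := norm_nonneg x.source
  nlinarith

theorem Data.hasMoment {p : ℝ} (hp : 0 ≤ p) {P : Measure (Data D)} [hP : IsProbabilityMeasure P]
    (h : ∫⁻ x, ENNReal.ofReal x.weight ^ p ∂P < ⊤) : HasMoment p P := by
  refine ⟨hP, Data.base D, (lintegral_mono fun x => ?_).trans_lt h⟩
  refine ENNReal.rpow_le_rpow ?_ hp
  rw [edist_dist]
  exact ENNReal.ofReal_le_ofReal x.dist_base_le

theorem hasMoment_map_solution (hd : 0 < d) (hD : Bornology.IsBounded D) {p : ℝ} (hp : 0 ≤ p)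
    {P : Measure (Data D)} [IsProbabilityMeasure P]
    (h : ∫⁻ x, ENNReal.ofReal x.weight ^ (2 * p) ∂P < ⊤) : HasMoment p (P.map solution) := by
  have hS := (continuous_solution hd hD).measurable
  refine ⟨Measure.isProbabilityMeasure_map hS.aemeasurable, 0, ?_⟩
  have hm : Measurable fun u : H01 D => edist u 0 ^ p :=
    (continuous_id.edist continuous_const).measurable.pow_const p
  rw [lintegral_map hm hS]
  have hw : Measurable fun x : Data D => ENNReal.ofReal x.weight ^ (2 * p) :=
    Data.continuous_weight.measurable.ennreal_ofReal.pow_const _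
  calc ∫⁻ x, edist (solution x) 0 ^ p ∂P
      ≤ ∫⁻ x, ENNReal.ofReal (poincareConst D) ^ p * ENNReal.ofReal x.weight ^ (2 * p) ∂P := by
        refine lintegral_mono fun x => ?_
        have h1 : (1 : ℝ≥0∞) ≤ ENNReal.ofReal x.weight := by
          rw [ENNReal.one_le_ofReal]
          exact x.one_le_weight
        have h2 : edist (solution x) 0 ≤
            ENNReal.ofReal (poincareConst D) * ENNReal.ofReal x.weight := by
          rw [← ENNReal.ofReal_mul poincareConst_nonneg, edist_dist, dist_zero_right]
          exact ENNReal.ofReal_le_ofReal (norm_solution_le_weight hd hD x)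
        refine (ENNReal.rpow_le_rpow h2 hp).trans ?_
        rw [ENNReal.mul_rpow_of_nonneg _ _ hp]
        gcongr
        linarith
    _ < ⊤ := by
        rw [lintegral_const_mul _ hw]
        exact ENNReal.mul_lt_top (ENNReal.rpow_lt_top_of_nonneg hp ENNReal.ofReal_ne_top) h

theorem edist_solution_le (hd : 0 < d) (hD : Bornology.IsBounded D) (x y : Data D) :
    edist (solution x) (solution y) ≤ ENNReal.ofReal (poincareConst D) *
      max (ENNReal.ofReal x.weight) (ENNReal.ofReal y.weight) * edist x y := by
  have h1 : 0 ≤ max x.weight y.weight :=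
    (zero_le_one.trans x.one_le_weight).trans (le_max_left _ _)
  rw [edist_dist, edist_dist x, ← ENNReal.ofReal_max, ← ENNReal.ofReal_mul poincareConst_nonneg,
    ← ENNReal.ofReal_mul (mul_nonneg poincareConst_nonneg h1)]
  exact ENNReal.ofReal_le_ofReal (dist_solution_le hd hD x y)

/-- The sensitivity estimate. If the Poincaré constant is `0`, which happens for `D = ∅`, the factor
`0` cannot be moved past the infimum over couplings, which might be `∞`; all solutions are `0` then,
and the left side vanishes. -/
theorem wasserstein_map_solution_le (hd : 0 < d) (hD : Bornology.IsBounded D) {p : ℝ} (hp : 1 ≤ p)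
    {P Q : Measure (Data D)} [IsProbabilityMeasure P] [IsProbabilityMeasure Q] {C : ℝ} (hC1 : 1 ≤ C)
    (hP : ∫⁻ x, ENNReal.ofReal x.weight ^ (2 * p) ∂P ≤ ENNReal.ofReal C)
    (hQ : ∫⁻ x, ENNReal.ofReal x.weight ^ (2 * p) ∂Q ≤ ENNReal.ofReal C) :
    wasserstein p (P.map solution) (Q.map solution) ≤
      ENNReal.ofReal (2 * poincareConst D * C ^ (1 / (2 * p))) * wasserstein (2 * p) P Q := by
  have hc : 0 ≤ poincareConst D := poincareConst_nonneg
  rcases hc.eq_or_lt with h0 | h0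
  · have hS : (solution : Data D → H01 D) = fun _ => 0 := by
      funext x
      have h1 : ‖(solution x : H01 D)‖ = 0 := by
        refine le_antisymm ?_ (norm_nonneg _)
        simpa [← h0] using norm_solution_le_weight hd hD x
      have h2 : ‖(solution x).toL2‖ ≤ 0 := by simpa [h1] using H01.norm_toL2_le hd hD (solution x)
      exact H01.ext (norm_le_zero_iff.1 h2) (norm_eq_zero.1 h1)
    simp only [hS, Measure.map_const, measure_univ, one_smul]
    rw [wasserstein_self (by linarith)]
    exact zero_le
  · have h := wasserstein_map_le (continuous_solution hd hD)
      Data.continuous_weight.measurable.ennreal_ofReal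
      (by simpa using h0) ENNReal.ofReal_ne_top
      (by simpa using zero_lt_one.trans_le hC1) ENNReal.ofReal_ne_top
      (edist_solution_le hd hD) hp hP hQ
    rwa [ENNReal.ofReal_rpow_of_nonneg (by linarith) (by positivity),
      show (2 : ℝ≥0∞) = ENNReal.ofReal 2 by simp, ← ENNReal.ofReal_mul (by norm_num),
      ← ENNReal.ofReal_mul (by positivity)] at h

end EllipticUQ

theorem mainTheorem8 {d : ℕ} (hd : 0 < d) (D : Set (EuclideanSpace ℝ (Fin d)))
    (hDo : IsOpen D) (hDb : Bornology.IsBounded D) :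
    -- well-posedness, with the a priori bound that determines the constant
    (∀ x : Data D, IsWeakSolution x (solution x) ∧
      (∀ u : H01 D, IsWeakSolution x u → u = solution x) ∧
      ∀ amin : ℝ, 0 < amin → (∀ᵐ y ∂(volume.restrict D), amin ≤ x.coeff.1 y) →
        ‖solution x‖ ≤ poincareConst D / amin * ‖x.source‖) ∧
    -- the solution operator is Borel measurable
    Measurable (solution (D := D)) ∧
    -- the sensitivity estimate
    ∀ (p : ℝ), 1 ≤ p → ∀ (P Q : Measure (Data D)), IsProbabilityMeasure P → IsProbabilityMeasure Q →
      ∀ C : ℝ,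
      ∫⁻ x, ENNReal.ofReal ((1 + ‖x.source‖) ^ (2 * p) * Real.exp (6 * p * ‖x.coeff.log‖)) ∂P
        ≤ ENNReal.ofReal C →
      ∫⁻ x, ENNReal.ofReal ((1 + ‖x.source‖) ^ (2 * p) * Real.exp (6 * p * ‖x.coeff.log‖)) ∂Q
        ≤ ENNReal.ofReal C →
      HasMoment (2 * p) P ∧ HasMoment (2 * p) Q ∧
      HasMoment p (P.map solution) ∧ HasMoment p (Q.map solution) ∧
      wasserstein p (P.map solution) (Q.map solution) ≤
        ENNReal.ofReal (2 * poincareConst D * C ^ (1 / (2 * p))) * wasserstein (2 * p) P Q ∧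
      (1 ≤ poincareConst D →
        wasserstein p (P.map solution) (Q.map solution) ≤
          ENNReal.ofReal (2 * poincareConst D ^ 2 * C ^ (1 / (2 * p))) * wasserstein (2 * p) P Q) := by
  refine ⟨fun x => ⟨isWeakSolution_solution hd hDb x,
    fun u hu => hu.unique hd hDb (isWeakSolution_solution hd hDb x),
    fun amin h0 ha => norm_solution_le hd hDb x h0 ha⟩,
    (continuous_solution hd hDb).measurable, ?_⟩
  intro p hp P Q iP iQ C hP hQ
  have hp0 : 0 ≤ p := by linarith
  simp only [← Data.ofReal_weight_rpow hp0] at hP hQ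
  have hP' := hP.trans_lt ENNReal.ofReal_lt_top
  have hQ' := hQ.trans_lt ENNReal.ofReal_lt_top
  -- The weight is at least `1`, so its moment bound forces `C ≥ 1`.
  have hC : 1 ≤ C := by
    rw [← ENNReal.one_le_ofReal]
    refine le_trans ?_ hP
    calc (1 : ℝ≥0∞) = ∫⁻ _, 1 ∂P := by simp
      _ ≤ _ := lintegral_mono fun x =>
        ENNReal.one_le_rpow (ENNReal.one_le_ofReal.2 x.one_le_weight) (by linarith)
  have hW := wasserstein_map_solution_le hd hDb hp hC hP hQ
  refine ⟨Data.hasMoment (by linarith) hP', Data.hasMoment (by linarith) hQ',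
    hasMoment_map_solution hd hDb hp0 hP', hasMoment_map_solution hd hDb hp0 hQ', hW,
    fun hc => hW.trans ?_⟩
  have hc2 : poincareConst D ≤ poincareConst D ^ 2 := le_self_pow₀ hc two_ne_zero
  gcongr
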